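/- Let $V$ be a valuation domain. The objects of $\mathcal C_V^*$ are the $V$-modules of projective dimension $\le 1$; a subobject of an object $M$ is a tight submodule, i.e. a submodule $A\le M$ such that $M/A$ has projective dimension $\le 1$. An object $M$ is called pure-injective if $\mathrm{Pext}^1_V(C,M)=0$ for all objects $C$, i.e. the only element of $\mathrm{Ext}^1_V(C,M)$ that is the class of a pure-exact sequence $0\to M\to N\to C\to 0$ is $0$. (Here the sequence is pure-exact if every finite system of linear equations over $V$ with right-hand sides in $M$ that is solvable in $N$ is solvable in $M$.) An object $C$ is called cotorsion if $\mathrm{Ext}^1_V(U,C)=0$ for every torsion-free uniserial object $U$, where a module is uniserial if its submodules form a chain under inclusion. Then: (i) Every pure-injective object of $\mathcal C_V^*$ is cotorsion. (ii) Every object $M$ of $\mathcal C_V^*$ is (isomorphic to) a subobject $A$ of some cotorsion object $C$ such that the cokernel $C/A$ is torsion-free. -/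

import Mathlib

open CategoryTheory

universe u w

namespace TightValuation

variable {V : Type u} [CommRing V]

section Purity

variable {M N : Type w} [AddCommGroup M] [Module V M] [AddCommGroup N] [Module V N]

/-- A linear map `f : M → N` is a pure embedding: every finite system of linear equations
with right-hand sides in `M` that has a solution in `N` already has a solution in `M`.
(The case of one equation without unknowns, `0 = a`, says that `f` is injective.) -/
def IsPureEmbedding (f : M →ₗ[V] N) : Prop :=
  ∀ (m n : ℕ) (r : Matrix (Fin m) (Fin n) V) (a : Fin m → M),
    (∃ y : Fin n → N, ∀ i, ∑ j, r i j • y j = f (a i)) →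
      ∃ x : Fin n → M, ∀ i, ∑ j, r i j • x j = a i

theorem IsPureEmbedding.injective {f : M →ₗ[V] N} (hf : IsPureEmbedding f) :
    Function.Injective f := by
  rw [injective_iff_map_eq_zero]
  intro a ha
  obtain ⟨x, hx⟩ := hf 1 0 0 (fun _ => a) ⟨0, fun i => by simp [ha]⟩
  simpa using (hx 0).symm

end Purity

variable (V) in
/-- A module is uniserial if its submodules form a chain under inclusion. -/
def IsUniserial (U : Type w) [AddCommGroup U] [Module V U] : Prop :=
  ∀ A B : Submodule V U, A ≤ B ∨ B ≤ A

variable [Small.{w} V]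

/-- The objects of `C_V^*`: the `V`-modules of projective dimension at most one. -/
def IsObject (M : ModuleCat.{w} V) : Prop :=
  HasProjectiveDimensionLE M 1

/-- The subobjects of an object `M` of `C_V^*`: the tight submodules, that is, those `A` for
which `M / A` has projective dimension at most one. -/
def IsTight {M : ModuleCat.{w} V} (A : Submodule V M) : Prop :=
  HasProjectiveDimensionLE (ModuleCat.of V (M ⧸ A)) 1

/-- `Pext^1(C, M)`, as a subset of `Ext^1(C, M)`: the classes of the pure extensions
`0 → M → N → C → 0`. -/
def Pext (C M : ModuleCat.{w} V) : Set (Abelian.Ext C M 1) :=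
  {e | ∃ (N : ModuleCat.{w} V) (f : M ⟶ N) (g : N ⟶ C) (h : f ≫ g = 0)
      (hS : (ShortComplex.mk f g h).ShortExact),
      IsPureEmbedding f.hom ∧ hS.extClass = e}

/-- An object `M` of `C_V^*` is pure-injective if `Pext^1(C, M) = 0` for all objects `C`. -/
def IsPureInjective (M : ModuleCat.{w} V) : Prop :=
  ∀ C : ModuleCat.{w} V, IsObject C → Pext C M = {0}

/-- An object `C` of `C_V^*` is cotorsion if `Ext^1(U, C) = 0` for all torsion-free uniserial
objects `U`. -/
def IsCotorsion (C : ModuleCat.{w} V) : Prop :=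
  ∀ U : ModuleCat.{w} V, IsObject U → IsUniserial V U → Module.IsTorsionFree V U →
    Subsingleton (Abelian.Ext U C 1)

end TightValuation

/-! Over a valuation domain torsion-free modules are flat, and an extension with flat quotient is
pure (`isPureEmbedding_of_flat`). So for torsion-free `U` every class in `Ext^1(U, M)` lies in
`Pext^1(U, M)`, which gives (i).

For (ii), torsion-free uniserial modules embed in the fraction field
(`exists_injective_fractionRing`), so a set of modules suffices to test cotorsion. Let `d : K → P`
be the direct sum of their presentations, with `K` and `P` projective; `C` is cotorsion once every
map `K → C` extends along `d`. Instead of by a transfinite chain of pushouts, `C` is built at once: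
adjoin to `M` a copy of `P` for each node `ν`, a code for a map from `K` into the module under
construction, and identify `d k` in that copy with the value coded at `k`. Every map `K → C` has a
code, whose copy of `P` extends it. Nodes refer only to nodes of lower rank, so a leading-term
argument shows that the relations are independent and saturated (`Node.relation_injective`,
`Node.mem_range_relation`). Hence `C / M` is torsion-free of projective dimension at most one. -/

namespace TightValuation

section Pushout

variable {V : Type u} [CommRing V] {K P Q M : Type w} [AddCommGroup K] [Module V K]
  [AddCommGroup P] [Module V P] [AddCommGroup Q] [Module V Q] [AddCommGroup M] [Module V M]

/-- The pushout of an extension `0 → K → P → Q → 0` along a linear map `K → M`. -/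
theorem exists_pushout_extension {i : K →ₗ[V] P} {q : P →ₗ[V] Q} (hi : Function.Injective i)
    (hiq : Function.Exact i q) (hq : Function.Surjective q) (φ : K →ₗ[V] M) :
    ∃ (N : ModuleCat.{w} V) (f : M →ₗ[V] N) (h : P →ₗ[V] N) (g : N →ₗ[V] Q),
      Function.Injective f ∧ Function.Exact f g ∧ Function.Surjective g ∧
      h ∘ₗ i = f ∘ₗ φ ∧ g ∘ₗ h = q := by
  let R : Submodule V (M × P) := LinearMap.range (φ.prod (-i))
  let f : M →ₗ[V] (M × P) ⧸ R := R.mkQ ∘ₗ LinearMap.inl V M P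
  let h : P →ₗ[V] (M × P) ⧸ R := R.mkQ ∘ₗ LinearMap.inr V M P
  let g : ((M × P) ⧸ R) →ₗ[V] Q := R.liftQ (q ∘ₗ LinearMap.snd V M P) (by
    rintro _ ⟨k, rfl⟩
    simp [hiq.apply_apply_eq_zero])
  refine ⟨ModuleCat.of V ((M × P) ⧸ R), f, h, g, ?_, ?_, ?_, ?_, ?_⟩
  · rw [injective_iff_map_eq_zero]
    intro m hm
    obtain ⟨k, hk⟩ := (Submodule.Quotient.mk_eq_zero R).1 hm
    have h1 : φ k = m := congrArg Prod.fst hk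
    have h2 : -i k = 0 := congrArg Prod.snd hk
    rw [neg_eq_zero, map_eq_zero_iff i hi] at h2
    rw [← h1, h2, map_zero]
  · intro y
    constructor
    · obtain ⟨⟨m, p⟩, rfl⟩ := R.mkQ_surjective y
      intro hy
      obtain ⟨k, rfl⟩ := (hiq p).1 hy
      refine ⟨m + φ k, ?_⟩
      refine (Submodule.Quotient.eq R).2 ⟨k, ?_⟩
      simp
    · rintro ⟨m, rfl⟩
      exact map_zero q
  · intro y
    obtain ⟨p, rfl⟩ := hq y
    exact ⟨h p, rfl⟩
  · ext k
    refine (Submodule.Quotient.eq R).2 ⟨-k, ?_⟩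
    simp
  · ext p
    rfl

end Pushout

/-! ### Well-founded codes and their relations -/

section Node

/-- A node is a function `K → M × (Node K P M →₀ P)`, the finitely supported second component
being presented as a finite sequence of terms. -/
inductive Node (K P M : Type w) : Type w
  | mk (m : K → M) (n : K → ℕ) (v : (k : K) → Fin (n k) → Node K P M)
      (p : (k : K) → Fin (n k) → P) : Node K P M

namespace Node

variable {K P M : Type w}

/-- The rank of a node exceeds the ranks of the nodes that occur in it. -/
noncomputable def rank : Node K P M → Ordinal.{w}
  | mk _ n v _ => ⨆ x : Σ k, Fin (n k), Order.succ (rank (v x.1 x.2))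

theorem rank_lt_rank_mk (m : K → M) (n : K → ℕ) (v : (k : K) → Fin (n k) → Node K P M)
    (p : (k : K) → Fin (n k) → P) (k : K) (i : Fin (n k)) : (v k i).rank < (mk m n v p).rank := by
  rw [rank]
  exact (Order.lt_succ _).trans_le
    (Ordinal.le_iSup (fun x : Σ k, Fin (n k) => Order.succ (rank (v x.1 x.2))) ⟨k, i⟩)

/-- The first component of a node. -/
def fst : Node K P M → K → M
  | mk m _ _ _ => m

variable [AddCommGroup P]

/-- The second component of a node. -/
noncomputable def snd : Node K P M → K → (Node K P M →₀ P)
  | mk _ n v p, k => ∑ i : Fin (n k), Finsupp.single (v k i) (p k i)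

theorem snd_apply_eq_zero {ν μ : Node K P M} (h : ν.rank ≤ μ.rank) (k : K) : ν.snd k μ = 0 := by
  cases ν with
  | mk m n v p =>
    rw [snd, Finsupp.finsetSum_apply]
    refine Finset.sum_eq_zero fun i _ => Finsupp.single_eq_of_ne ?_
    rintro rfl
    exact (rank_lt_rank_mk m n v p k i).not_ge h

theorem exists_fst_snd (m : K → M) (x : K → (Node K P M →₀ P)) :
    ∃ ν : Node K P M, ν.fst = m ∧ ν.snd = x := by
  let e := fun k => (x k).support.equivFin
  refine ⟨mk m (fun k => (x k).support.card) (fun k i => (e k).symm i)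
    (fun k i => x k ((e k).symm i)), rfl, ?_⟩
  funext k
  rw [snd, Equiv.sum_comp (e k).symm
    (fun a : (x k).support => Finsupp.single (a : Node K P M) (x k a)),
    Finset.sum_coe_sort (x k).support (fun a => Finsupp.single a (x k a))]
  exact (x k).sum_single

variable {V : Type u} [CommRing V] [AddCommGroup K] [Module V K] [Module V P]
  (s : K →ₗ[V] K →₀ V) (d : K →ₗ[V] P)

/-- The linear map `K → M` that a section `s` of `(K →₀ V) → K` makes of the first component. -/
noncomputable def fstLinear [AddCommGroup M] [Module V M] (ν : Node K P M) : K →ₗ[V] M :=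
  Finsupp.linearCombination V ν.fst ∘ₗ s

/-- The linear map `K → (Node K P M →₀ P)` that a section `s` of `(K →₀ V) → K` makes of the
second component. -/
noncomputable def sndLinear (ν : Node K P M) : K →ₗ[V] (Node K P M →₀ P) :=
  Finsupp.linearCombination V ν.snd ∘ₗ s

theorem sndLinear_apply_eq_zero {ν μ : Node K P M} (h : ν.rank ≤ μ.rank) (k : K) :
    ν.sndLinear s k μ = 0 := by
  simp [sndLinear, Finsupp.linearCombination_apply, Finsupp.sum, Finsupp.finsetSum_apply,
    snd_apply_eq_zero h]

/-- The relations between the generators: `d k` at the node `ν` is identified with the element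
that `ν` assigns to `k`. -/
noncomputable def relation : (Node K P M →₀ K) →ₗ[V] (Node K P M →₀ P) :=
  Finsupp.lsum V fun ν => Finsupp.lsingle ν ∘ₗ d - ν.sndLinear s

theorem relation_single (ν : Node K P M) (k : K) :
    relation s d (Finsupp.single ν k) = Finsupp.single ν (d k) - ν.sndLinear s k := by
  simp [relation]

theorem relation_apply_of_rank_le (g : Node K P M →₀ K) (ν : Node K P M)
    (h : ∀ μ ∈ g.support, μ.rank ≤ ν.rank) : relation s d g ν = d (g ν) := by
  classical
  rw [relation, Finsupp.lsum_apply, Finsupp.sum, Finsupp.finsetSum_apply]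
  have : ∀ μ ∈ g.support, ((Finsupp.lsingle μ ∘ₗ d - μ.sndLinear s) (g μ)) ν =
      if μ = ν then d (g ν) else 0 := by
    intro μ hμ
    simp only [LinearMap.sub_apply, Finsupp.sub_apply, sndLinear_apply_eq_zero s (h μ hμ),
      sub_zero, LinearMap.comp_apply, Finsupp.lsingle_apply, Finsupp.single_apply]
    split_ifs with hν
    · rw [hν]
    · rfl
  rw [Finset.sum_congr rfl this, Finset.sum_ite_eq']
  split_ifs with hν
  · rfl
  · rw [Finsupp.notMem_support_iff.1 hν, map_zero]

/-- A node of maximal rank in the support occurs in no node of the support, so only the leading term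
contributes there. -/
theorem exists_relation_apply (g : Node K P M →₀ K) (hg : g ≠ 0) :
    ∃ ν ∈ g.support, relation s d g ν = d (g ν) := by
  obtain ⟨ν, hν, h⟩ := g.support.exists_max_image rank (Finsupp.support_nonempty_iff.2 hg)
  exact ⟨ν, hν, relation_apply_of_rank_le s d g ν h⟩

variable {d}

theorem relation_injective (hd : Function.Injective d) :
    Function.Injective (relation s d (M := M)) := by
  rw [injective_iff_map_eq_zero]
  intro g hg
  by_contra h0
  obtain ⟨ν, hν, h⟩ := exists_relation_apply s d g h0
  rw [hg, Finsupp.zero_apply, eq_comm, map_eq_zero_iff d hd] at h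
  exact Finsupp.mem_support_iff.1 hν h

theorem mem_range_relation (hd : Function.Injective d) [Module.IsTorsionFree V P]
    (hsat : ∀ (r : V) (p : P), IsRegular r → r • p ∈ LinearMap.range d → p ∈ LinearMap.range d)
    {r : V} (hr : IsRegular r) (x : Node K P M →₀ P)
    (hx : r • x ∈ LinearMap.range (relation s d (M := M))) :
    x ∈ LinearMap.range (relation s d (M := M)) := by
  obtain ⟨g, hg⟩ := hx
  induction hn : g.support.card using Nat.strong_induction_on generalizing g x with
  | _ n ih =>
  by_cases h0 : g = 0
  · rw [h0, map_zero] at hg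
    have : x = 0 := by
      ext ν
      apply hr.isSMulRegular (M := P)
      simpa using (DFunLike.congr_fun hg ν).symm
    rw [this]
    exact zero_mem _
  · obtain ⟨ν, hν, h⟩ := exists_relation_apply s d g h0
    rw [hg, Finsupp.smul_apply] at h
    -- Saturation makes the leading coefficient of `g` divisible by `r`; subtracting from `x` the
    -- relation of `k` at `ν` removes `ν` from the support of `g`.
    obtain ⟨k, hk⟩ := hsat r (x ν) hr ⟨g ν, h.symm⟩
    have hgk : g ν = r • k := hd (by rw [← h, map_smul, hk])
    have hE : g = g.erase ν + Finsupp.single ν (r • k) := by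
      rw [← hgk, Finsupp.erase_add_single]
    have key := ih (g.erase ν).support.card
      (by
        classical
        rw [← hn, Finsupp.support_erase]
        exact Finset.card_erase_lt_of_mem hν)
      (x - relation s d (Finsupp.single ν k)) (g.erase ν)
      (by
        rw [smul_sub, ← hg, ← map_smul, ← map_sub]
        congr 1
        rw [Finsupp.smul_single, eq_sub_iff_add_eq, ← hE]) rfl
    simpa using add_mem key (LinearMap.mem_range_self (relation s d) (Finsupp.single ν k))

end Node

end Node

/-! ### The extension property -/

section Extension

variable {V : Type u} [CommRing V] {K P M : Type w} [AddCommGroup K] [Module V K]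
  [AddCommGroup P] [Module V P] [AddCommGroup M] [Module V M]

theorem isTorsionFree_quotient {A : Submodule V P}
    (h : ∀ (r : V) (p : P), IsRegular r → r • p ∈ A → p ∈ A) :
    Module.IsTorsionFree V (P ⧸ A) where
  isSMulRegular r hr := by
    refine IsSMulRegular.of_right_eq_zero_of_smul fun x hx => ?_
    obtain ⟨p, rfl⟩ := A.mkQ_surjective x
    exact (Submodule.Quotient.mk_eq_zero A).2 (h r p hr ((Submodule.Quotient.mk_eq_zero A).1 hx))

/-- Given `d : K → P`, every module `M` embeds in a module `C` such that all linear maps `K → C`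
extend along `d` and `C / M` has a presentation by direct sums of copies of `K` and `P`. -/
theorem exists_extension_property [Module.Projective V K] [Module.IsTorsionFree V P]
    {d : K →ₗ[V] P} (hd : Function.Injective d)
    (hsat : ∀ (r : V) (p : P), IsRegular r → r • p ∈ LinearMap.range d → p ∈ LinearMap.range d)
    (M : Type w) [AddCommGroup M] [Module V M] :
    ∃ (C : ModuleCat.{w} V) (Q : ModuleCat.{w} V) (ι : Type w) (f : M →ₗ[V] C) (g : C →ₗ[V] Q)
      (i : (ι →₀ K) →ₗ[V] (ι →₀ P)) (q : (ι →₀ P) →ₗ[V] Q),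
      Function.Injective f ∧ Function.Exact f g ∧ Function.Surjective g ∧
      Function.Injective i ∧ Function.Exact i q ∧ Function.Surjective q ∧
      Module.IsTorsionFree V Q ∧
      ∀ ψ : K →ₗ[V] C, ∃ χ : P →ₗ[V] C, χ ∘ₗ d = ψ := by
  obtain ⟨s, hs⟩ := Module.projective_def'.1 (inferInstance : Module.Projective V K)
  let i := Node.relation s d (M := M)
  have hi : Function.Injective i := Node.relation_injective s hd
  have hiq : Function.Exact i (LinearMap.range i).mkQ := LinearMap.exact_map_mkQ_range i
  have hq : Function.Surjective (LinearMap.range i).mkQ := Submodule.mkQ_surjective _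
  obtain ⟨C, f, h, g, hf, hfg, hg, hcomm, hgh⟩ := exists_pushout_extension hi hiq hq
    (Finsupp.lsum V fun ν : Node K P M => ν.fstLinear s)
  refine ⟨C, ModuleCat.of V (_ ⧸ LinearMap.range i), Node K P M, f, g, i,
    (LinearMap.range i).mkQ, hf, hfg, hg, hi, hiq, hq,
    isTorsionFree_quotient fun r p hr => Node.mem_range_relation s hd hsat hr p, fun ψ => ?_⟩
  have hrep : ∀ k : K, ∃ (m : M) (x : Node K P M →₀ P), f m + h x = ψ k := by
    intro k
    obtain ⟨x, hx⟩ := hq (g (ψ k))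
    obtain ⟨m, hm⟩ := (hfg (ψ k - h x)).1 (by
      rw [map_sub, ← hx, ← hgh, LinearMap.comp_apply, sub_self])
    exact ⟨m, x, by rw [hm, sub_add_cancel]⟩
  choose m x hmx using hrep
  -- The choices `m` and `x` need not be linear; extending them linearly to `K →₀ V` and composing
  -- with `s` gives linear maps that still represent `ψ`.
  obtain ⟨ν, hν₁, hν₂⟩ := Node.exists_fst_snd m x
  refine ⟨h ∘ₗ Finsupp.lsingle ν, ?_⟩
  have hψ : f ∘ₗ ν.fstLinear s + h ∘ₗ ν.sndLinear s = ψ := by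
    have : f ∘ₗ Finsupp.linearCombination V m + h ∘ₗ Finsupp.linearCombination V x =
        ψ ∘ₗ Finsupp.linearCombination V id := by
      ext k
      simp [hmx]
    rw [Node.fstLinear, Node.sndLinear, hν₁, hν₂, ← LinearMap.comp_assoc, ← LinearMap.comp_assoc,
      ← LinearMap.add_comp, this, LinearMap.comp_assoc, hs, LinearMap.comp_id]
  rw [← hψ]
  ext k
  have := DFunLike.congr_fun hcomm (Finsupp.single ν k)
  simp only [LinearMap.comp_apply, i, Node.relation_single, map_sub, Finsupp.lsum_single] at this
  simpa [sub_eq_iff_eq_add] using this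

end Extension

end TightValuation

namespace TightValuation

/-! ### Ext and projective presentations -/

section Presentation

variable {V : Type u} [CommRing V] [Small.{w} V]

theorem ext_one_eq_extClass_comp {S : ShortComplex (ModuleCat.{w} V)} (hS : S.ShortExact)
    [Projective S.X₂] {Y : ModuleCat.{w} V} (e : Abelian.Ext S.X₃ Y 1) :
    ∃ φ : S.X₁ ⟶ Y, hS.extClass.comp (Abelian.Ext.mk₀ φ) (add_zero 1) = e := by
  obtain ⟨x, hx⟩ := Abelian.Ext.contravariant_sequence_exact₃ hS Y e
    (Abelian.Ext.eq_zero_of_projective _) (add_zero 1)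
  exact ⟨Abelian.Ext.homEquiv₀ x, by rw [Abelian.Ext.mk₀_homEquiv₀_apply, hx]⟩

theorem subsingleton_ext_one_of_extension_property {S : ShortComplex (ModuleCat.{w} V)}
    (hS : S.ShortExact) [Projective S.X₂] {Y : ModuleCat.{w} V}
    (h : ∀ ψ : S.X₁ ⟶ Y, ∃ χ : S.X₂ ⟶ Y, S.f ≫ χ = ψ) :
    Subsingleton (Abelian.Ext S.X₃ Y 1) := by
  refine subsingleton_of_forall_eq 0 fun e => ?_
  obtain ⟨φ, rfl⟩ := ext_one_eq_extClass_comp hS e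
  obtain ⟨χ, rfl⟩ := h φ
  rw [← Abelian.Ext.mk₀_comp_mk₀, ShortComplex.ShortExact.extClass_comp_assoc]

/-- The chosen projective cover map of `U`, as a linear map. -/
noncomputable abbrev presentation (U : ModuleCat.{w} V) :
    (Projective.over U : ModuleCat.{w} V) →ₗ[V] U :=
  (Projective.π U).hom

theorem presentation_surjective (U : ModuleCat.{w} V) : Function.Surjective (presentation U) :=
  (ModuleCat.epi_iff_surjective _).1 inferInstance

instance (U : ModuleCat.{w} V) : Module.Projective V (Projective.over U : ModuleCat.{w} V) :=
  (IsProjective.iff_projective _).2 (inferInstanceAs (Projective (Projective.over U)))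

theorem projective_ker_presentation {U : ModuleCat.{w} V} (hU : IsObject U) :
    Module.Projective V (LinearMap.ker (presentation U)) := by
  rw [IsProjective.iff_projective, projective_iff_hasProjectiveDimensionLT_one]
  exact (LinearMap.shortExact_shortComplexKer
    (presentation_surjective U)).hasProjectiveDimensionLT_X₁ 1
    (projective_iff_hasProjectiveDimensionLT_one.1
      (inferInstanceAs (Projective (Projective.over U)))) hU

theorem exists_shortExact_extClass_eq {U M : ModuleCat.{w} V} (e : Abelian.Ext U M 1) :
    ∃ (N : ModuleCat.{w} V) (f : M ⟶ N) (g : N ⟶ U) (h : f ≫ g = 0)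
      (hS : (ShortComplex.mk f g h).ShortExact), hS.extClass = e := by
  have hP := LinearMap.shortExact_shortComplexKer (presentation_surjective U)
  have : Projective (presentation U).shortComplexKer.X₂ :=
    inferInstanceAs (Projective (Projective.over U))
  obtain ⟨φ, rfl⟩ := ext_one_eq_extClass_comp hP e
  obtain ⟨N, f, h, g, hf, hfg, hg, hcomm, hgh⟩ := exists_pushout_extension
    (LinearMap.ker (presentation U)).injective_subtype (LinearMap.exact_subtype_ker_map _)
    (presentation_surjective U) φ.hom
  have h0 : ModuleCat.ofHom f ≫ ModuleCat.ofHom g = 0 := by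
    ext x
    exact hfg.apply_apply_eq_zero x
  have hS : (ShortComplex.mk (ModuleCat.ofHom f) (ModuleCat.ofHom g) h0).ShortExact :=
    ModuleCat.shortComplex_shortExact _ hfg hf hg
  refine ⟨N, ModuleCat.ofHom f, ModuleCat.ofHom g, h0, hS, ?_⟩
  let τ : (presentation U).shortComplexKer ⟶
      ShortComplex.mk (ModuleCat.ofHom f) (ModuleCat.ofHom g) h0 :=
    { τ₁ := φ
      τ₂ := ModuleCat.ofHom h
      τ₃ := 𝟙 U
      comm₁₂ := ModuleCat.hom_ext hcomm.symm
      comm₂₃ := ModuleCat.hom_ext hgh }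
  have := ShortComplex.ShortExact.extClass_naturality hP hS τ
  exact ((Abelian.Ext.mk₀_id_comp hS.extClass).symm.trans this.symm)

end Presentation

/-! ### Flatness and purity -/

section Pure

variable {V : Type u} [CommRing V] {M N U : Type w} [AddCommGroup M] [Module V M]
  [AddCommGroup N] [Module V N] [AddCommGroup U] [Module V U]

theorem isPureEmbedding_of_flat [Module.Flat V U] {f : M →ₗ[V] N} {g : N →ₗ[V] U}
    (hf : Function.Injective f) (hfg : Function.Exact f g) (hg : Function.Surjective g) :
    IsPureEmbedding f := by
  classical
  rintro m n (r : Fin m → Fin n → V) a ⟨y, hy⟩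
  have hr : ∀ i, Fintype.linearCombination V r (Pi.single i 1) = r i := by simp
  have h0 : (g ∘ₗ Fintype.linearCombination V y) ∘ₗ Fintype.linearCombination V r = 0 := by
    ext i
    simp only [LinearMap.comp_apply, LinearMap.coe_single, hr, LinearMap.zero_apply]
    rw [Fintype.linearCombination_apply, hy, hfg.apply_apply_eq_zero]
  -- The images `g (y j)` solve the homogeneous system. By flatness this solution comes from one in
  -- a free module; lifted to `N`, it corrects `y` to a solution in the range of `f`.
  obtain ⟨k, b, z, hbz, hb⟩ := Module.Flat.exists_factorization_of_comp_eq_zero_of_free h0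
  obtain ⟨z', rfl⟩ := Module.projective_lifting_property g z hg
  let t := Fintype.linearCombination V y - z' ∘ₗ b
  have ht : ∀ c, t c ∈ LinearMap.range f := fun c => (hfg _).1 (by
    have := DFunLike.congr_fun hbz c
    simpa [t, sub_eq_zero] using this)
  have htr : ∀ i, t (r i) = f (a i) := by
    intro i
    have := DFunLike.congr_fun hb (Pi.single i 1)
    rw [LinearMap.comp_apply, hr, LinearMap.zero_apply] at this
    simp [t, this, Fintype.linearCombination_apply, hy i]
  choose x hx using fun j : Fin n => ht (Pi.single j 1)
  refine ⟨x, fun i => hf ?_⟩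
  rw [← htr i, map_sum]
  simp only [map_smul, hx]
  conv_rhs => rw [pi_eq_sum_univ' (r i), map_sum]
  simp

end Pure

/-! ### Torsion-free and uniserial modules -/

section Uniserial

variable {V : Type u} [CommRing V] [IsDomain V] {U : Type w} [AddCommGroup U] [Module V U]

theorem flat_of_isTorsionFree [ValuationRing V] [Module.IsTorsionFree V U] : Module.Flat V U :=
  Module.Flat.flat_iff_torsion_eq_bot_of_isBezout.2
    (Submodule.isTorsionFree_iff_torsion_eq_bot.1 inferInstance)

/-- Fix `b ≠ 0`. Cyclic submodules are comparable, so each `x` satisfies `s • x = r • b` with `s ≠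
0`; send `x` to `r / s`. -/
theorem exists_injective_fractionRing [Module.IsTorsionFree V U] (hU : IsUniserial V U) :
    ∃ f : U →ₗ[V] FractionRing V, Function.Injective f := by
  by_cases h0 : ∀ x : U, x = 0
  · exact ⟨0, fun x y _ => (h0 x).trans (h0 y).symm⟩
  push Not at h0
  obtain ⟨b, hb⟩ := h0
  have key : ∀ x : U, ∃ r s : V, s ≠ 0 ∧ s • x = r • b := by
    intro x
    rcases hU (V ∙ x) (V ∙ b) with h | h
    · obtain ⟨r, hr⟩ := Submodule.mem_span_singleton.1
        (h (Submodule.mem_span_singleton_self x))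
      exact ⟨r, 1, one_ne_zero, by rw [one_smul, hr]⟩
    · obtain ⟨s, hs⟩ := Submodule.mem_span_singleton.1
        (h (Submodule.mem_span_singleton_self b))
      refine ⟨1, s, ?_, by rw [one_smul, hs]⟩
      rintro rfl
      exact hb (by rw [← hs, zero_smul])
  choose r s hs hrs using key
  let q : U → FractionRing V := fun x =>
    algebraMap V (FractionRing V) (r x) / algebraMap V (FractionRing V) (s x)
  have hne : ∀ {c : V}, c ≠ 0 → algebraMap V (FractionRing V) c ≠ 0 := fun hc => by
    simpa using hc
  have hq : ∀ (x : U) (r' s' : V), s' ≠ 0 → s' • x = r' • b →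
      q x = algebraMap V (FractionRing V) r' / algebraMap V (FractionRing V) s' := by
    intro x r' s' hs' h
    have : s' * r x = s x * r' := by
      apply smul_left_injective V hb
      simp only [mul_smul]
      rw [← hrs, ← h, smul_comm]
    rw [div_eq_div_iff (hne (hs x)) (hne hs'), ← map_mul, ← map_mul, mul_comm, this, mul_comm]
  refine ⟨{ toFun := q, map_add' := fun x y => ?_, map_smul' := fun c x => ?_ }, ?_⟩
  · rw [hq (x + y) (s y * r x + s x * r y) (s x * s y) (mul_ne_zero (hs x) (hs y))]
    · have hx := hne (hs x)
      have hy := hne (hs y)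
      simp only [q, map_add, map_mul]
      field_simp
    · rw [smul_add, add_smul, mul_smul, mul_smul, mul_smul, mul_smul, ← hrs, ← hrs,
        smul_comm (s x) (s y) x]
  · rw [hq (c • x) (c * r x) (s x) (hs x) (by rw [smul_comm, hrs, mul_smul])]
    simp only [q, map_mul, Algebra.smul_def, RingHom.id_apply, mul_div_assoc]
  · rw [injective_iff_map_eq_zero]
    intro x hx
    change q x = 0 at hx
    have hr : r x = 0 := by
      by_contra hr
      exact div_ne_zero (hne hr) (hne (hs x)) hx
    have := hrs x
    rw [hr, zero_smul, smul_eq_zero] at this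
    exact this.resolve_left (hs x)

instance [Small.{w} V] : Small.{w} (FractionRing V) :=
  small_of_surjective (f := fun x : V × nonZeroDivisors V => Localization.mk x.1 x.2) fun z =>
    Localization.induction_on z fun x => ⟨x, rfl⟩

end Uniserial

end TightValuation

namespace TightValuation

/-! ### Projective dimension at most one -/

section Object

variable {V : Type u} [CommRing V]

theorem projective_finsupp (ι : Type*) (P : Type*) [AddCommGroup P] [Module V P]
    [Module.Projective V P] : Module.Projective V (ι →₀ P) := by
  classical
  exact .of_equiv (finsuppLequivDFinsupp (ι := ι) (M := P) V).symm

theorem isObject_of_presentation {F G : Type w} [AddCommGroup F]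
    [Module V F] [AddCommGroup G] [Module V G] [Module.Projective V F] [Module.Projective V G]
    {Q : ModuleCat.{w} V} {i : G →ₗ[V] F} {q : F →ₗ[V] Q} (hi : Function.Injective i)
    (hiq : Function.Exact i q) (hq : Function.Surjective q) : IsObject Q := by
  have hS : (ModuleCat.shortComplexOfCompEqZero i q hiq.linearMap_comp_eq_zero).ShortExact :=
    ModuleCat.shortComplex_shortExact _ hiq hi hq
  have h₁ : Projective (ModuleCat.of V G) := inferInstance
  have h₂ : Projective (ModuleCat.of V F) := inferInstance
  exact (hS.hasProjectiveDimensionLT_X₃_iff 0 h₂).2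
    (projective_iff_hasProjectiveDimensionLT_one.1 h₁)

theorem isObject_of_extension {M C Q : ModuleCat.{w} V} {f : M →ₗ[V] C} {g : C →ₗ[V] Q}
    (hf : Function.Injective f) (hfg : Function.Exact f g) (hg : Function.Surjective g)
    (hM : IsObject M) (hQ : IsObject Q) : IsObject C :=
  (ModuleCat.shortComplex_shortExact
    (ModuleCat.shortComplexOfCompEqZero f g hfg.linearMap_comp_eq_zero)
    hfg hf hg).hasProjectiveDimensionLT_X₂ 2 hM hQ

end Object

/-! ### Cotorsion objects -/

section Cotorsion

variable {V : Type u} [CommRing V] [Small.{w} V]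

theorem IsPureInjective.isCotorsion [IsDomain V] [ValuationRing V] {M : ModuleCat.{w} V}
    (hM : IsPureInjective M) : IsCotorsion M := by
  intro U hU _ _
  have : Module.Flat V U := flat_of_isTorsionFree
  refine subsingleton_of_forall_eq 0 fun e => ?_
  obtain ⟨N, f, g, h, hS, he⟩ := exists_shortExact_extClass_eq e
  have hpure : IsPureEmbedding f.hom := isPureEmbedding_of_flat (g := g.hom)
    ((ModuleCat.mono_iff_injective f).1 hS.mono_f)
    ((ShortComplex.ShortExact.moduleCat_exact_iff_function_exact _).1 hS.exact)
    ((ModuleCat.epi_iff_surjective g).1 hS.epi_g)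
  have hmem : e ∈ Pext U M := ⟨N, f, g, h, hS, hpure, he⟩
  rw [hM U hU] at hmem
  exact hmem

theorem subsingleton_ext_one_of_ker_extension {U A C : ModuleCat.{w} V} (e : A ≃ₗ[V] U)
    (h : ∀ ψ : LinearMap.ker (presentation A) →ₗ[V] C,
      ∃ χ : (Projective.over A : ModuleCat.{w} V) →ₗ[V] C,
        χ ∘ₗ (LinearMap.ker (presentation A)).subtype = ψ) :
    Subsingleton (Abelian.Ext U C 1) := by
  have hP := LinearMap.shortExact_shortComplexKer (presentation_surjective A)
  have : Projective (presentation A).shortComplexKer.X₂ :=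
    inferInstanceAs (Projective (Projective.over A))
  have hA : Subsingleton (Abelian.Ext A C 1) :=
    subsingleton_ext_one_of_extension_property hP fun ψ => by
      obtain ⟨χ, hχ⟩ := h ψ.hom
      exact ⟨ModuleCat.ofHom χ, ModuleCat.hom_ext hχ⟩
  refine subsingleton_of_forall_eq 0 fun x => ?_
  have hx := Abelian.Ext.mk₀_id_comp x
  rw [← e.toModuleIso.inv_hom_id, ← Abelian.Ext.mk₀_comp_mk₀_assoc,
    Subsingleton.elim ((Abelian.Ext.mk₀ _).comp x (zero_add 1)) (0 : Abelian.Ext A C 1),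
    Abelian.Ext.comp_zero] at hx
  exact hx.symm

theorem exists_isCotorsion_embedding [IsDomain V] (M : ModuleCat.{w} V) (hM : IsObject M) :
    ∃ (C Q : ModuleCat.{w} V) (f : M →ₗ[V] C) (g : C →ₗ[V] Q),
      Function.Injective f ∧ Function.Exact f g ∧ Function.Surjective g ∧
      IsObject C ∧ IsCotorsion C ∧ IsObject Q ∧ Module.IsTorsionFree V Q := by
  classical
  let W : Type w := Shrink.{w} (FractionRing V)
  have : Module.IsTorsionFree V W :=
    (Shrink.linearEquiv V (FractionRing V)).injective.moduleIsTorsionFree _ (map_smul _)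
  -- All submodules that are objects are taken, uniserial or not; passing to `W` keeps the index
  -- type in `Type w`.
  let ι : Type w := {A : Submodule V W // IsObject (ModuleCat.of V A)}
  let U : ι → ModuleCat.{w} V := fun a => ModuleCat.of V a.1
  have (a : ι) : Module.Projective V (LinearMap.ker (presentation (U a))) :=
    projective_ker_presentation a.2
  let d : (Π₀ a : ι, LinearMap.ker (presentation (U a))) →ₗ[V]
      (Π₀ a : ι, (Projective.over (U a) : ModuleCat.{w} V)) :=
    DFinsupp.mapRange.linearMap fun a => (LinearMap.ker (presentation (U a))).subtype
  have hd : Function.Injective d :=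
    (DFinsupp.mapRange_injective _ fun _ => map_zero _).2 fun a =>
      (LinearMap.ker (presentation (U a))).injective_subtype
  -- The cokernel of `d` is the direct sum of the torsion-free `U a`.
  have hsat : ∀ (r : V) p, IsRegular r → r • p ∈ LinearMap.range d → p ∈ LinearMap.range d := by
    intro r p hr
    simp only [d, DFinsupp.range_mapRangeLinearMap, Submodule.mem_comap, Submodule.mem_pi,
      Submodule.range_subtype, LinearMap.mem_ker, Set.mem_univ, true_imp_iff]
    intro h a
    refine hr.isSMulRegular.right_eq_zero_of_smul (?_ : r • presentation (U a) (p a) = 0)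
    rw [← map_smul]
    exact h a
  obtain ⟨C, Q, κ, f, g, i, q, hf, hfg, hg, hi, hiq, hq, hQ, hext⟩ :=
    exists_extension_property hd hsat M
  have := projective_finsupp (V := V) κ (Π₀ a : ι, LinearMap.ker (presentation (U a)))
  have := projective_finsupp (V := V) κ (Π₀ a : ι, (Projective.over (U a) : ModuleCat.{w} V))
  have hQ' : IsObject Q := isObject_of_presentation hi hiq hq
  refine ⟨C, Q, f, g, hf, hfg, hg, isObject_of_extension hf hfg hg hM hQ', ?_, hQ', hQ⟩
  intro T hT hTu _
  obtain ⟨j, hj⟩ := exists_injective_fractionRing hTu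
  let j' : T →ₗ[V] W := (Shrink.linearEquiv V (FractionRing V)).symm.toLinearMap ∘ₗ j
  have hj' : Function.Injective j' := ((Shrink.linearEquiv V (FractionRing V)).symm.injective).comp hj
  let e : T ≃ₗ[V] LinearMap.range j' := LinearEquiv.ofInjective j' hj'
  let a : ι := ⟨LinearMap.range j', by
    have : HasProjectiveDimensionLT T 2 := hT
    exact hasProjectiveDimensionLT_of_iso e.toModuleIso 2⟩
  refine subsingleton_ext_one_of_ker_extension (A := U a) e.symm fun ψ => ?_
  obtain ⟨χ, hχ⟩ := hext (ψ ∘ₗ DFinsupp.lapply a)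
  refine ⟨χ ∘ₗ DFinsupp.lsingle (M := fun a : ι => (Projective.over (U a) : ModuleCat.{w} V)) a, ?_⟩
  ext k
  simpa [d] using DFunLike.congr_fun hχ (DFinsupp.single a k)

end Cotorsion

end TightValuation

theorem mainTheorem7 {V : Type u} [CommRing V] [IsDomain V] [ValuationRing V] [Small.{w} V] :
    (∀ M : ModuleCat.{w} V, TightValuation.IsObject M → TightValuation.IsPureInjective M →
      TightValuation.IsCotorsion M) ∧
    (∀ M : ModuleCat.{w} V, TightValuation.IsObject M →
      ∃ (C : ModuleCat.{w} V) (A : Submodule V C),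
        TightValuation.IsObject C ∧ TightValuation.IsCotorsion C ∧
        TightValuation.IsTight A ∧ Nonempty (M ≃ₗ[V] A) ∧
        Module.IsTorsionFree V (C ⧸ A)) := by
  refine ⟨fun M _ hM => hM.isCotorsion, fun M hM => ?_⟩
  obtain ⟨C, Q, f, g, hf, hfg, hg, hC, hCcot, hQ, hQtf⟩ :=
    TightValuation.exists_isCotorsion_embedding M hM
  let e : (C ⧸ LinearMap.range f) ≃ₗ[V] Q :=
    (Submodule.quotEquivOfEq _ _ (LinearMap.exact_iff.1 hfg).symm).trans
      (g.quotKerEquivOfSurjective hg)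
  refine ⟨C, LinearMap.range f, hC, hCcot, ?_, ⟨LinearEquiv.ofInjective f hf⟩,
    e.injective.moduleIsTorsionFree _ (map_smul e)⟩
  have : HasProjectiveDimensionLT Q 2 := hQ
  exact hasProjectiveDimensionLT_of_iso e.symm.toModuleIso 2
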